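/- Let $G$ be a finite connected graph without loops or multiple edges, with $m$ edges, and let $D(G)$ be its set of $2m$ arcs (each edge $uv$ gives the arcs $(u,v)$ and $(v,u)$). For $e=(u,v)\in D(G)$ write $o(e)=u$, $t(e)=v$, $e^{-1}=(v,u)$. Let $\mathbf W=(\mathbf W_{uv})_{u,v\in V(G)}$ be a matrix over the quaternions $\mathbb H$ with $\mathbf W_{uv}=0$ whenever $(u,v)\notin D(G)$, and put $w(e)=\mathbf W_{uv}$ for $e=(u,v)\in D(G)$. Let $\mathbf B_w$ and $\mathbf J_0$ be the matrices indexed by $D(G)$ whose $(e,f)$-entries are, respectively, $w(f)$ if $t(e)=o(f)$ and $0$ otherwise, and $1$ if $f=e^{-1}$ and $0$ otherwise. Let $\tilde w(e,f)$ be the $(e,f)$-entry of $\mathbf B_w-\mathbf J_0$. For a square quaternionic matrix $\mathbf M=\mathbf S+j\mathbf P$ with $\mathbf S,\mathbf P$ complex, the Study determinant is $$\operatorname{Sdet}(\mathbf M)=\det\begin{bmatrix}\mathbf S&-\overline{\mathbf P}\\ \mathbf P&\overline{\mathbf S}\end{bmatrix},$$ and for a quaternion $t$ the quaternionic second weighted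 zeta function of $G$ is $\mathbf Z_1^{\mathbb H}(G,w,t)=\operatorname{Sdet}\big(\mathbf I_{2m}-t(\mathbf B_w-\mathbf J_0)\big)^{-1}$. A Lyndon word over $[2m]=\{1,\dots,2m\}$ is a nonempty word that is not a power $v^r$ with $r\ge 2$ of another word and that is lexicographically minimal among its cyclic rearrangements. Fix any enumeration $e_1,\dots,e_{2m}$ of $D(G)$. Let $t$ be a real number with $|t|$ so small that $|t|\,|\tilde w(e,f)|<1/(8m^2)$ for all $e,f\in D(G)$. Then $\operatorname{Sdet}\big(\mathbf I_{2m}-t(\mathbf B_w-\mathbf J_0)\big)\neq 0$, and $$\mathbf Z_1^{\mathbb H}(G,w,t)=\prod_{i_1i_2\cdots i_d}\big|1-\tilde w(e_{i_1},e_{i_2})\,\tilde w(e_{i_2},e_{i_3})\cdots\tilde w(e_{i_d},e_{i_1})\,t^d\big|^{-2},$$ where the product runs over all Lyndon words $i_1i_2\cdots i_d$ over $[2m]$ (of every length $d\ge 1$), none of the quantities inside $|\cdot|$ is zero, and the product converges unconditionally, that is, independently of the order of the factors. -/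

import Mathlib

open scoped Quaternion

noncomputable section

/-- The simplex part `a = x₀ + x₁ i` of a quaternion `x = a + j b`. -/
def simplexPart (x : ℍ[ℝ]) : ℂ := ⟨x.re, x.imI⟩

/-- The perplex part `b = x₂ - x₃ i` of a quaternion `x = a + j b`. -/
def perplexPart (x : ℍ[ℝ]) : ℂ := ⟨x.imJ, -x.imK⟩

/-- The complex matrix `ψ(M)` of a quaternionic matrix `M = S + j P`, namely the block matrix
with rows `(S, -conj P)` and `(P, conj S)`. -/
def quatPsi {ι : Type*} (M : Matrix ι ι ℍ[ℝ]) : Matrix (ι ⊕ ι) (ι ⊕ ι) ℂ :=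
  Matrix.fromBlocks
    (M.map simplexPart) (M.map fun x => -(starRingEnd ℂ) (perplexPart x))
    (M.map perplexPart) (M.map fun x => (starRingEnd ℂ) (simplexPart x))

/-- The Study determinant of a square quaternionic matrix. -/
def studyDet {ι : Type*} [Fintype ι] [DecidableEq ι] (M : Matrix ι ι ℍ[ℝ]) : ℂ :=
  (quatPsi M).det

/-- `W` is a quaternionic weighted matrix of `G`: its entry at `(u, v)` vanishes unless `(u, v)`
is an arc of `G`. -/
def IsQuatWeightedMatrix {V : Type*} (G : SimpleGraph V) (W : Matrix V V ℍ[ℝ]) : Prop :=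
  ∀ u v : V, ¬ G.Adj u v → W u v = 0

section Arcs

variable {V : Type*} [DecidableEq V] (G : SimpleGraph V)

/-- The matrix `B_w`, indexed by the arcs (darts) of `G`: the entry at `(e, f)` is `w(f)` if the
terminal of `e` is the origin of `f`, and `0` otherwise. -/
def arcMatrix (W : Matrix V V ℍ[ℝ]) : Matrix G.Dart G.Dart ℍ[ℝ] :=
  Matrix.of fun e f => if e.snd = f.fst then W f.fst f.snd else 0

/-- The matrix `J₀`: the entry at `(e, f)` is `1` if `f` is the inverse arc of `e`, and `0`
otherwise. -/
def arcInvMatrix : Matrix G.Dart G.Dart ℍ[ℝ] :=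
  Matrix.of fun e f => if f = e.symm then 1 else 0

/-- `w̃(e, f)`, the `(e, f)`-entry of `B_w - J₀`. -/
def wTilde (W : Matrix V V ℍ[ℝ]) (e f : G.Dart) : ℍ[ℝ] :=
  (arcMatrix G W - arcInvMatrix G) e f

variable [Fintype V] [DecidableRel G.Adj]

/-- `Sdet (I - t (B_w - J₀))`, for a quaternion `t` that multiplies the entries from the left. -/
def zetaDet (W : Matrix V V ℍ[ℝ]) (t : ℍ[ℝ]) : ℂ :=
  studyDet (1 - t • (arcMatrix G W - arcInvMatrix G))

/-- The quaternionic second weighted zeta function of `G`. -/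
def quatZeta (W : Matrix V V ℍ[ℝ]) (t : ℍ[ℝ]) : ℂ :=
  (zetaDet G W t)⁻¹

end Arcs

/-- A Lyndon word: a nonempty word which is prime (not a power `v ^ r` of a word, `r ≥ 2`) and
which is lexicographically minimal among its cyclic rearrangements. -/
def IsLyndonWord {α : Type*} [LinearOrder α] (l : List α) : Prop :=
  l ≠ [] ∧
  (∀ (v : List α) (r : ℕ), 2 ≤ r → l ≠ (List.replicate r v).flatten) ∧
  ∀ k : ℕ, l ≤ l.rotate k

/-- For a word `l = i₁ i₂ ⋯ i_d`, the ordered product `a i₁ i₂ * a i₂ i₃ * ⋯ * a i_d i₁`. -/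
def cyclicProd {α : Type*} (a : α → α → ℍ[ℝ]) (l : List α) : ℍ[ℝ] :=
  (List.zipWith a l (l.rotate 1)).prod

end

/-! ### Logarithm of `det (1 - M)` for complex matrices -/

section ComplexMatrix

open Polynomial

variable {ι : Type*} [Fintype ι] [DecidableEq ι]

/-! Both sides are exponentials of one absolutely convergent sum over words. Write `M` for `t` times
the weights. Since `quatPsi` is multiplicative and its trace is twice the real trace, the inverse
Study determinant of `1 - M` is the exponential of the sum over `k` of `2 Re tr(M ^ k) / k`
(`exists_hasSum_studyDet`). Expanding the trace turns this into a sum over words `w` of `2 Re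
(cyclicProd w) / |w|` (`hasSum_re_cyclicProd_div_length`). Every nonempty word is, in exactly one
way, a rotation by `j < |l|` of a power `l ^ (r + 1)` of a Lyndon word (`lyndonRotation_injective`,
`exists_lyndonRotation_eq`). Real parts of cyclic products ignore rotation, so the `|l|` rotations
cancel the factor `|l|` in the length. What remains for `l`, with `q` its cyclic product, is the
series of `-2 log ‖1 - q‖`, which is the 1×1 case of the same expansion. Summing over `l` and
exponentiating gives the product; absolute convergence makes the order irrelevant. -/

theorem Matrix.det_sub_algebraMap_eq_prod_roots {K : Type*} [Field K] [IsAlgClosed K]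
    (M : Matrix ι ι K) (a : K) :
    (M - algebraMap K (Matrix ι ι K) a).det = (M.charpoly.roots.map fun μ => μ - a).prod := by
  have hM := IsAlgClosed.splits M.charpoly
  have hcard : M.charpoly.roots.card = Fintype.card ι := by
    rw [← hM.natDegree_eq_card_roots, Matrix.charpoly_natDegree_eq_dim]
  rw [← neg_sub, Matrix.det_neg, ← hcard, Matrix.algebraMap_eq_diagonal]
  have h := Matrix.eval_charpoly M a
  rw [Matrix.scalar_apply] at h
  have h2 : (Matrix.diagonal (algebraMap K (ι → K) a) - M).det = M.charpoly.eval a := h.symm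
  rw [h2, hM.eval_eq_prod_roots_of_monic M.charpoly_monic,
    ← Multiset.card_map (fun μ => a - μ), ← Multiset.prod_map_neg, Multiset.map_map]
  simp

/-- Both sides are multiplicative in `p`, so splitting `p` reduces the claim to constants and linear
factors. -/
theorem Matrix.det_aeval_eq_prod_roots {K : Type*} [Field K] [IsAlgClosed K]
    (M : Matrix ι ι K) (p : K[X]) :
    (aeval M p).det = (M.charpoly.roots.map fun μ => p.eval μ).prod := by
  have hcard : M.charpoly.roots.card = Fintype.card ι := by
    rw [← (IsAlgClosed.splits M.charpoly).natDegree_eq_card_roots,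
      Matrix.charpoly_natDegree_eq_dim]
  have key : ∀ (R : Multiset K) (c : K),
      (aeval M (C c * (R.map fun a => X - C a).prod)).det =
        (M.charpoly.roots.map fun μ => (C c * (R.map fun a => X - C a).prod).eval μ).prod := by
    intro R c
    induction R using Multiset.induction_on with
    | empty => simp [Matrix.algebraMap_eq_diagonal, hcard]
    | cons a R ih =>
      rw [Multiset.map_cons, Multiset.prod_cons, mul_left_comm, map_mul, Matrix.det_mul, ih]
      simp only [eval_mul (p := X - C a), Multiset.prod_map_mul]
      simp [M.det_sub_algebraMap_eq_prod_roots a]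
  have h := key p.roots p.leadingCoeff
  rwa [← (IsAlgClosed.splits p).eq_prod_roots] at h

theorem Matrix.trace_pow_eq_sum_roots {K : Type*} [Field K] [IsAlgClosed K]
    (M : Matrix ι ι K) (k : ℕ) :
    (M ^ k).trace = (M.charpoly.roots.map fun μ => μ ^ k).sum := by
  have h : (M ^ k).charpoly.roots = M.charpoly.roots.map fun μ => μ ^ k := by
    have h' : (M ^ k).charpoly = ((M.charpoly.roots.map fun μ => μ ^ k).map fun a => X - C a).prod := by
      refine Polynomial.funext fun z => ?_
      -- This choice evaluates the characteristic polynomial of `M ^ k` at `z`, so its roots are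
      -- found with multiplicity.
      have hz := M.det_aeval_eq_prod_roots (C z - X ^ k)
      rw [Matrix.eval_charpoly, Polynomial.eval_multiset_prod]
      simpa [Matrix.algebraMap_eq_diagonal, Function.comp_def, Pi.algebraMap_def] using hz
    rw [h', roots_multiset_prod_X_sub_C]
  rw [Matrix.trace_eq_sum_roots_charpoly, h]

/-- The Taylor series of `-log (1 - μ)` are added over the eigenvalues. Only `exp s` is identified,
which avoids comparing branches of the logarithm of a product. -/
theorem Matrix.hasSum_trace_pow_div (M : Matrix ι ι ℂ) (hM : ∀ μ ∈ M.charpoly.roots, ‖μ‖ < 1) :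
    (1 - M).det ≠ 0 ∧ ∃ s : ℂ, HasSum (fun k : ℕ => (M ^ k).trace / k) s ∧
      Complex.exp s = (1 - M).det⁻¹ := by
  have h1 : (1 - M).det = (M.charpoly.roots.map fun μ => 1 - μ).prod := by
    have h := M.det_aeval_eq_prod_roots (1 - X)
    rw [map_sub, map_one, aeval_X] at h
    simpa only [eval_sub, eval_one, eval_X] using h
  have key : ∀ R : Multiset ℂ, (∀ μ ∈ R, ‖μ‖ < 1) → (R.map fun μ => 1 - μ).prod ≠ 0 ∧
      ∃ s : ℂ, HasSum (fun k : ℕ => (R.map fun μ => μ ^ k).sum / k) s ∧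
        Complex.exp s = ((R.map fun μ => 1 - μ).prod)⁻¹ := by
    intro R
    induction R using Multiset.induction_on with
    | empty => intro _; exact ⟨by simp, 0, by simp, by simp⟩
    | cons a R ih =>
      intro h
      obtain ⟨h0, s, hs, he⟩ := ih fun μ hμ => h μ (Multiset.mem_cons_of_mem hμ)
      have ha := h a (Multiset.mem_cons_self a R)
      have ha1 : 1 - a ≠ 0 := by
        intro h
        rw [← sub_eq_zero.mp h] at ha
        simp at ha
      refine ⟨by simp [ha1, h0], -Complex.log (1 - a) + s, ?_, ?_⟩
      · simpa [add_div] using (Complex.hasSum_taylorSeries_neg_log ha).add hs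
      · rw [Complex.exp_add, Complex.exp_neg, Complex.exp_log ha1, he]
        simp [mul_comm]
  simpa only [h1, Matrix.trace_pow_eq_sum_roots] using key _ hM

/-- Gershgorin's discs, weakened to a bound by absolute row sums. -/
theorem Matrix.norm_le_of_mem_roots_charpoly (M : Matrix ι ι ℂ) {b : ℝ}
    (hM : ∀ i, ∑ j, ‖M i j‖ ≤ b) : ∀ μ ∈ M.charpoly.roots, ‖μ‖ ≤ b := by
  intro μ hμ
  have h : Module.End.HasEigenvalue (Matrix.toLin' M) μ := by
    rw [Module.End.hasEigenvalue_iff_mem_spectrum, Matrix.spectrum_toLin']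
    exact Matrix.mem_spectrum_of_isRoot_charpoly (isRoot_of_mem_roots hμ)
  obtain ⟨k, hk⟩ := eigenvalue_mem_ball h
  rw [mem_closedBall_iff_norm] at hk
  refine le_trans ?_ (hM k)
  rw [← Finset.add_sum_erase _ _ (Finset.mem_univ k)]
  calc ‖μ‖ = ‖M k k + (μ - M k k)‖ := by ring_nf
    _ ≤ ‖M k k‖ + ‖μ - M k k‖ := norm_add_le _ _
    _ ≤ _ := by gcongr

end ComplexMatrix

/-! ### The complex representation of quaternionic matrices and the Study determinant -/

section QuatPsi

theorem simplexPart_mul (x y : ℍ[ℝ]) : simplexPart (x * y) =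
    simplexPart x * simplexPart y - (starRingEnd ℂ) (perplexPart x) * perplexPart y := by
  apply Complex.ext <;> simp [simplexPart, perplexPart] <;> ring

theorem perplexPart_mul (x y : ℍ[ℝ]) : perplexPart (x * y) =
    perplexPart x * simplexPart y + (starRingEnd ℂ) (simplexPart x) * perplexPart y := by
  apply Complex.ext <;> simp [simplexPart, perplexPart] <;> ring

theorem simplexPart_sum {κ : Type*} (s : Finset κ) (f : κ → ℍ[ℝ]) :
    simplexPart (∑ i ∈ s, f i) = ∑ i ∈ s, simplexPart (f i) :=
  map_sum (AddMonoidHom.mk' simplexPart fun _ _ => rfl) f s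

theorem perplexPart_sum {κ : Type*} (s : Finset κ) (f : κ → ℍ[ℝ]) :
    perplexPart (∑ i ∈ s, f i) = ∑ i ∈ s, perplexPart (f i) :=
  map_sum (AddMonoidHom.mk' perplexPart fun x y => by
    apply Complex.ext <;> simp [perplexPart]; ring) f s

theorem sq_norm_eq_simplexPart_add_perplexPart (x : ℍ[ℝ]) :
    ‖x‖ ^ 2 = ‖simplexPart x‖ ^ 2 + ‖perplexPart x‖ ^ 2 := by
  rw [sq ‖x‖, ← Quaternion.normSq_eq_norm_mul_self, Quaternion.normSq_def', Complex.sq_norm,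
    Complex.sq_norm, Complex.normSq_apply, Complex.normSq_apply]
  simp only [simplexPart, perplexPart]
  ring

theorem norm_simplexPart_le (x : ℍ[ℝ]) : ‖simplexPart x‖ ≤ ‖x‖ := by
  rw [← sq_le_sq₀ (norm_nonneg _) (norm_nonneg _), sq_norm_eq_simplexPart_add_perplexPart]
  exact le_add_of_nonneg_right (sq_nonneg _)

theorem norm_perplexPart_le (x : ℍ[ℝ]) : ‖perplexPart x‖ ≤ ‖x‖ := by
  rw [← sq_le_sq₀ (norm_nonneg _) (norm_nonneg _), sq_norm_eq_simplexPart_add_perplexPart]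
  exact le_add_of_nonneg_left (sq_nonneg _)

variable {ι : Type*}

theorem quatPsi_one [DecidableEq ι] : quatPsi (1 : Matrix ι ι ℍ[ℝ]) = 1 := by
  ext (i | i) (j | j) <;>
    by_cases h : i = j <;> simp [quatPsi, Matrix.one_apply, h, simplexPart, perplexPart] <;>
    apply Complex.ext <;> simp

theorem quatPsi_sub (M N : Matrix ι ι ℍ[ℝ]) : quatPsi (M - N) = quatPsi M - quatPsi N := by
  ext (i | i) (j | j) <;> apply Complex.ext <;>
    simp [quatPsi, simplexPart, perplexPart, sub_eq_add_neg, add_comm]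

variable [Fintype ι]

theorem quatPsi_mul (M N : Matrix ι ι ℍ[ℝ]) : quatPsi (M * N) = quatPsi M * quatPsi N := by
  rw [quatPsi, quatPsi, quatPsi, Matrix.fromBlocks_multiply]
  congr 1 <;> ext i j
  all_goals
    simp only [Matrix.map_apply, Matrix.add_apply, Matrix.mul_apply, simplexPart_sum,
      perplexPart_sum, map_sum, ← Finset.sum_add_distrib, ← Finset.sum_neg_distrib]
    refine Finset.sum_congr rfl fun k _ => ?_
    simp only [simplexPart_mul, perplexPart_mul, map_sub, map_add, map_mul, Complex.conj_conj] <;> ring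

theorem quatPsi_pow [DecidableEq ι] (M : Matrix ι ι ℍ[ℝ]) (k : ℕ) :
    quatPsi (M ^ k) = quatPsi M ^ k := by
  induction k with
  | zero => simp [quatPsi_one]
  | succ k ih => rw [pow_succ, quatPsi_mul, ih, pow_succ]

theorem trace_quatPsi (M : Matrix ι ι ℍ[ℝ]) :
    (quatPsi M).trace = ((∑ i, 2 * (M i i).re : ℝ) : ℂ) := by
  simp only [Matrix.trace, Fintype.sum_sum_type, ← Finset.sum_add_distrib, Complex.ofReal_sum]
  refine Finset.sum_congr rfl fun i _ => ?_
  apply Complex.ext <;> simp [quatPsi, simplexPart]; ring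

theorem sum_norm_quatPsi_le {M : Matrix ι ι ℍ[ℝ]} {c : ℝ} (hM : ∀ i j, ‖M i j‖ ≤ c)
    (x : ι ⊕ ι) : ∑ y, ‖quatPsi M x y‖ ≤ 2 * Fintype.card ι * c := by
  have h : ∀ x y, ‖quatPsi M x y‖ ≤ c := by
    rintro (i | i) (j | j) <;> simp only [quatPsi, Matrix.fromBlocks_apply₁₁,
      Matrix.fromBlocks_apply₁₂, Matrix.fromBlocks_apply₂₁, Matrix.fromBlocks_apply₂₂,
      Matrix.map_apply, norm_neg, RCLike.norm_conj]
    · exact (norm_simplexPart_le _).trans (hM i j)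
    · exact (norm_perplexPart_le _).trans (hM i j)
    · exact (norm_perplexPart_le _).trans (hM i j)
    · exact (norm_simplexPart_le _).trans (hM i j)
  refine (Finset.sum_le_sum fun y _ => h x y).trans (le_of_eq ?_)
  rw [Finset.sum_const, Finset.card_univ, Fintype.card_sum, nsmul_eq_mul]
  push_cast
  ring

variable [DecidableEq ι]

theorem studyDet_submatrix_equiv {κ : Type*} [Fintype κ] [DecidableEq κ] (e : κ ≃ ι)
    (M : Matrix ι ι ℍ[ℝ]) : studyDet (M.submatrix e e) = studyDet M := by
  rw [studyDet, studyDet, ← Matrix.det_submatrix_equiv_self (e.sumCongr e) (quatPsi M)]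
  congr 1
  ext (i | i) (j | j) <;> simp [quatPsi]

theorem studyDet_fin_one (q : ℍ[ℝ]) :
    studyDet (Matrix.of fun _ _ : Fin 1 => q) = ((‖q‖ ^ 2 : ℝ) : ℂ) := by
  rw [studyDet, ← Matrix.det_submatrix_equiv_self finSumFinEquiv.symm, Matrix.det_fin_two]
  have h0 : (finSumFinEquiv (m := 1) (n := 1)).symm 0 = Sum.inl 0 := rfl
  have h1 : (finSumFinEquiv (m := 1) (n := 1)).symm 1 = Sum.inr 0 := rfl
  rw [sq_norm_eq_simplexPart_add_perplexPart]
  push_cast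
  simp only [Matrix.submatrix_apply, h0, h1, quatPsi, Matrix.fromBlocks_apply₁₁,
      Matrix.fromBlocks_apply₁₂, Matrix.fromBlocks_apply₂₁, Matrix.fromBlocks_apply₂₂,
      Matrix.map_apply, Matrix.of_apply]
  rw [← Complex.mul_conj', ← Complex.conj_mul']
  ring

/-- The logarithmic expansion of the Study determinant of `1 - M`. -/
theorem exists_hasSum_studyDet {M : Matrix ι ι ℍ[ℝ]} {c : ℝ} (hM : ∀ i j, ‖M i j‖ ≤ c)
    (hc : 2 * Fintype.card ι * c < 1) :
    studyDet (1 - M) ≠ 0 ∧ ∃ s : ℝ,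
      HasSum (fun k : ℕ => (∑ i, 2 * ((M ^ k) i i).re) / (k : ℝ)) s ∧
      (Real.exp s : ℂ) = (studyDet (1 - M))⁻¹ := by
  obtain ⟨h0, s, hs, he⟩ := (quatPsi M).hasSum_trace_pow_div fun μ hμ =>
    ((quatPsi M).norm_le_of_mem_roots_charpoly (sum_norm_quatPsi_le hM) μ hμ).trans_lt hc
  have hdet : (1 - quatPsi M).det = studyDet (1 - M) := by
    rw [studyDet, quatPsi_sub, quatPsi_one]
  rw [hdet] at h0 he
  simp only [← quatPsi_pow, trace_quatPsi] at hs
  norm_cast at hs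
  have hre := Complex.hasSum_re hs
  have hs' : HasSum (fun k : ℕ => (∑ i, 2 * ((M ^ k) i i).re) / (k : ℝ)) s.re := by
    simpa using hre
  refine ⟨h0, s.re, hs', ?_⟩
  rw [← he, Complex.ofReal_exp]
  congr 1
  -- The terms are real, so the complex sum `s` equals its real part.
  exact (Complex.hasSum_ofReal.mpr hs').unique (by simpa using hs)

/-- The 1×1 case of `exists_hasSum_studyDet`; the factor 2 in the hypothesis is inherited from its
crude row-sum bound. -/
theorem hasSum_log_norm_one_sub {q : ℍ[ℝ]} (hq : 2 * ‖q‖ < 1) :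
    HasSum (fun k : ℕ => 2 * (q ^ k).re / (k : ℝ)) (Real.log (‖1 - q‖ ^ (-2 : ℤ))) := by
  obtain ⟨h0, s, hs, he⟩ := exists_hasSum_studyDet (M := Matrix.of fun _ _ : Fin 1 => q)
    (c := ‖q‖) (fun _ _ => le_rfl) (by simpa using hq)
  have hsub : (1 - Matrix.of fun _ _ : Fin 1 => q) = Matrix.of fun _ _ : Fin 1 => 1 - q := by
    ext1 i j
    simp [Subsingleton.elim i j]
  have hpow : ∀ k : ℕ, (Matrix.of fun _ _ : Fin 1 => q) ^ k = Matrix.of fun _ _ => q ^ k := by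
    intro k
    induction k with
    | zero => ext1 i j; simp [Subsingleton.elim i j]
    | succ k ih => ext1 i j; simp [pow_succ, ih, Matrix.mul_apply]
  rw [hsub, studyDet_fin_one, ← Complex.ofReal_inv, Complex.ofReal_inj] at he
  have hz : ‖1 - q‖ ^ (-2 : ℤ) = Real.exp s := by
    rw [he, zpow_neg]
    norm_cast
  rw [hz, Real.log_exp]
  simpa [hpow] using hs

end QuatPsi

/-! ### Powers of words and commuting words -/

section WordPowers

variable {α : Type*}

theorem List.flatten_replicate_succ (n : ℕ) (v : List α) :
    (List.replicate (n + 1) v).flatten = v ++ (List.replicate n v).flatten := by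
  simp [List.replicate_succ]

theorem List.flatten_replicate_add (m n : ℕ) (v : List α) :
    (List.replicate (m + n) v).flatten =
      (List.replicate m v).flatten ++ (List.replicate n v).flatten := by
  rw [List.replicate_add, List.flatten_append]

theorem List.flatten_replicate_mul (m n : ℕ) (v : List α) :
    (List.replicate (m * n) v).flatten =
      (List.replicate m (List.replicate n v).flatten).flatten := by
  induction m with
  | zero => simp
  | succ m ih => rw [add_one_mul, add_comm, flatten_replicate_add, ih, flatten_replicate_succ]

theorem List.flatten_replicate_append_comm (n : ℕ) (v : List α) :
    (List.replicate n v).flatten ++ v = v ++ (List.replicate n v).flatten := by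
  rw [← flatten_replicate_succ, flatten_replicate_add]
  simp

theorem List.flatten_replicate_append_conj (n : ℕ) (p q : List α) :
    (List.replicate n (p ++ q)).flatten ++ p = p ++ (List.replicate n (q ++ p)).flatten := by
  induction n with
  | zero => simp
  | succ n ih => simp [flatten_replicate_succ, ih]

theorem List.rotate_flatten_replicate (n k : ℕ) (v : List α) :
    ((List.replicate n v).flatten).rotate k = (List.replicate n (v.rotate k)).flatten := by
  induction k with
  | zero => simp
  | succ k ih =>
    rw [← rotate_rotate, ih, ← rotate_rotate]
    generalize v.rotate k = u
    cases n with
    | zero => simp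
    | succ n =>
      cases u with
      | nil => simp
      | cons a u =>
        have h := flatten_replicate_append_conj n [a] u
        rw [flatten_replicate_succ, flatten_replicate_succ]
        simp only [singleton_append] at h
        simp [h]

/-- Euclid's algorithm on lengths: the shorter word is a prefix of the longer, and cancelling it
leaves a shorter commuting pair. -/
theorem List.exists_flatten_replicate_of_append_comm (u v : List α) (h : u ++ v = v ++ u) :
    ∃ (z : List α) (a b : ℕ),
      u = (List.replicate a z).flatten ∧ v = (List.replicate b z).flatten := by
  induction hn : u.length + v.length using Nat.strong_induction_on generalizing u v with
  | _ n ih =>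
    wlog hle : u.length ≤ v.length generalizing u v with H
    · obtain ⟨z, a, b, ha, hb⟩ := H v u h.symm (by omega) (by omega)
      exact ⟨z, b, a, hb, ha⟩
    rcases eq_or_ne u [] with rfl | hu
    · exact ⟨v, 0, 1, by simp, by simp⟩
    obtain ⟨w, rfl⟩ : u <+: v :=
      prefix_of_prefix_length_le (h ▸ prefix_append u v) (prefix_append v u) hle
    have hpos := length_pos_of_ne_nil hu
    have h' : u ++ w = w ++ u := by simpa using h
    obtain ⟨z, a, b, ha, hb⟩ := ih _ (by rw [← hn, length_append]; omega) u w h' rfl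
    exact ⟨z, a, a + b, ha, by rw [flatten_replicate_add, ← ha, ← hb]⟩

/-- The common power `N` commutes with `x` and `y`, so `x ++ y` and `y ++ x` are prefixes of `N ++
N` of equal length. -/
theorem List.append_comm_of_flatten_replicate_eq {x y : List α} {r s : ℕ}
    (h : (List.replicate (r + 1) x).flatten = (List.replicate (s + 1) y).flatten) :
    x ++ y = y ++ x := by
  set N := (List.replicate (r + 1) x).flatten with hN
  have hx : x <+: N := by rw [hN, flatten_replicate_succ]; exact prefix_append _ _
  have hy : y <+: N := by rw [h, flatten_replicate_succ]; exact prefix_append _ _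
  have hxN : N ++ x = x ++ N := flatten_replicate_append_comm _ _
  have hyN : N ++ y = y ++ N := by rw [h]; exact flatten_replicate_append_comm _ _
  have h1 : x ++ y <+: N ++ N :=
    (((prefix_append_right_inj x).mpr hy).trans (by rw [← hxN])).trans
      ((prefix_append_right_inj N).mpr hx)
  have h2 : y ++ x <+: N ++ N :=
    (((prefix_append_right_inj y).mpr hx).trans (by rw [← hyN])).trans
      ((prefix_append_right_inj N).mpr hy)
  have hlen : (x ++ y).length = (y ++ x).length := by simp [add_comm]
  exact (prefix_of_prefix_length_le h1 h2 hlen.le).eq_of_length hlen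

theorem List.append_lt_append_of_length_eq [LinearOrder α] {a b : List α} (h : a < b)
    (hl : a.length = b.length) (x y : List α) : a ++ x < b ++ y := by
  induction a generalizing b with
  | nil => cases b with
    | nil => simp at h
    | cons b t => simp at hl
  | cons i a ih => cases b with
    | nil => simp at hl
    | cons j b =>
      simp only [cons_append, cons_lt_cons_iff] at h ⊢
      rcases h with h | ⟨h1, h2⟩
      · exact Or.inl h
      · exact Or.inr ⟨h1, ih h2 (by simpa using hl)⟩

end WordPowers

/-! ### Lyndon words: primitivity and minimality of their powers -/

namespace IsLyndonWord

variable {α : Type*} [LinearOrder α] {l l' : List α}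

theorem length_pos (h : IsLyndonWord l) : 0 < l.length := List.length_pos_of_ne_nil h.1

theorem exponent_eq_one (h : IsLyndonWord l) {z : List α} {a : ℕ}
    (ha : l = (List.replicate a z).flatten) : a = 1 := by
  match a with
  | 0 => exact absurd (by simpa using ha) h.1
  | 1 => rfl
  | a + 2 => exact absurd ha (h.2.1 z _ (by omega))

/-- If a rotation fixed `l`, its two pieces would commute and be powers of one word; primitivity
makes the exponents add up to 1, so one piece would be empty. -/
theorem rotate_ne_self (h : IsLyndonWord l) {d : ℕ} (hd : 0 < d) (hdl : d < l.length) :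
    l.rotate d ≠ l := by
  intro hrot
  rw [List.rotate_eq_drop_append_take hdl.le] at hrot
  obtain ⟨z, a, b, ha, hb⟩ := List.exists_flatten_replicate_of_append_comm (l.take d) (l.drop d)
    (by rw [hrot, List.take_append_drop])
  have hab : a + b = 1 := h.exponent_eq_one (z := z) (by
    rw [List.flatten_replicate_add, ← ha, ← hb, List.take_append_drop])
  have h1 : (l.take d).length = d := by rw [List.length_take]; omega
  have h2 : (l.drop d).length = l.length - d := List.length_drop
  rcases a with _ | a
  · rw [ha] at h1; simp at h1; omega
  · have hb0 : b = 0 := by omega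
    rw [hb, hb0] at h2; simp at h2; omega

theorem flatten_replicate_le_rotate (h : IsLyndonWord l) (r k : ℕ) :
    (List.replicate r l).flatten ≤ ((List.replicate r l).flatten).rotate k := by
  rw [List.rotate_flatten_replicate]
  rcases (h.2.2 k).eq_or_lt with heq | hlt
  · rw [← heq]
  · cases r with
    | zero => simp
    | succ r =>
      rw [List.flatten_replicate_succ, List.flatten_replicate_succ]
      exact (List.append_lt_append_of_length_eq hlt (by simp) _ _).le

theorem eq_of_flatten_replicate_eq (h : IsLyndonWord l) (h' : IsLyndonWord l') {r s : ℕ}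
    (heq : (List.replicate (r + 1) l).flatten = (List.replicate (s + 1) l').flatten) :
    l = l' := by
  obtain ⟨z, a, b, ha, hb⟩ := List.exists_flatten_replicate_of_append_comm l l'
    (List.append_comm_of_flatten_replicate_eq heq)
  rw [ha, hb, h.exponent_eq_one ha, h'.exponent_eq_one hb]

end IsLyndonWord

/-- The word `l ^ (r + 1)` rotated by `j`, where `l` is a Lyndon word and `j < |l|`. -/
def lyndonRotation {α : Type*} [LinearOrder α]
    (p : Σ l : {l : List α // IsLyndonWord l}, ℕ × Fin l.1.length) : List α :=
  ((List.replicate (p.2.1 + 1) p.1.1).flatten).rotate p.2.2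

/-! ### Unique factorization of words into rotated Lyndon powers -/

section LyndonRotation

variable {α : Type*} [LinearOrder α]

/-- The power is the least word of its rotation class, hence determined by it; then commutation
gives `l`, length gives `r`, and primitivity gives the offset. -/
theorem lyndonRotation_injective : Function.Injective (lyndonRotation (α := α)) := by
  rintro ⟨⟨l, hl⟩, r, j⟩ ⟨⟨l', hl'⟩, s, j'⟩ h
  simp only [lyndonRotation] at h
  have key : ∀ {u v : List α} {m n : ℕ}, u.rotate m = v.rotate n → ∃ k, v.rotate k = u := by
    intro u v m n huv
    have h1 : v ~r u.rotate m := ⟨n, huv.symm⟩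
    exact h1.trans (List.IsRotated.symm ⟨m, rfl⟩)
  have hw : (List.replicate (r + 1) l).flatten = (List.replicate (s + 1) l').flatten := by
    apply le_antisymm
    · obtain ⟨k, hk⟩ := key h.symm
      exact hk ▸ hl.flatten_replicate_le_rotate _ k
    · obtain ⟨k, hk⟩ := key h
      exact hk ▸ hl'.flatten_replicate_le_rotate _ k
  obtain rfl := hl.eq_of_flatten_replicate_eq hl' hw
  have hrs : r = s := by
    have := congrArg List.length hw
    simpa [hl.1] using this
  subst hrs
  have hrot : l.rotate j = l.rotate j' := by
    rw [List.rotate_flatten_replicate, List.rotate_flatten_replicate,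
      List.flatten_replicate_succ, List.flatten_replicate_succ] at h
    exact (List.append_inj h (by simp)).1
  have hj : j = j' := by
    clear h
    by_contra hne
    wlog hlt : j < j' generalizing j j' with H
    · exact H j' j hrot.symm (Ne.symm hne) (lt_of_le_of_ne (not_lt.mp hlt) (Ne.symm hne))
    have hlt' : (j : ℕ) < j' := hlt
    refine hl.rotate_ne_self (d := (j' : ℕ) - j) (by omega)
      ((Nat.sub_le _ _).trans_lt j'.2) ?_
    apply List.rotate_injective (j : ℕ)
    simp only [List.rotate_rotate]
    rw [Nat.sub_add_cancel hlt'.le, hrot]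
  rw [hj]

/-- The Lyndon word is the shortest root `v` of the least rotation of `w`: shortness makes it
primitive, and a smaller rotation of `v` would give a smaller rotation of `w`. -/
theorem exists_lyndonRotation_eq {w : List α} (hw : w ≠ []) : ∃ p, lyndonRotation p = w := by
  have hpos := List.length_pos_of_ne_nil hw
  obtain ⟨k₀, hk₀, hmin⟩ := Finset.exists_min_image (Finset.range w.length) (fun k => w.rotate k)
    ⟨0, by simpa using hpos⟩
  rw [Finset.mem_range] at hk₀
  have hmin' : ∀ k, w.rotate k₀ ≤ w.rotate k := fun k => by
    rw [← List.rotate_mod w k]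
    exact hmin _ (Finset.mem_range.mpr (Nat.mod_lt _ hpos))
  have hex : ∃ n, ∃ (v : List α) (r : ℕ), v.length = n ∧
      w.rotate k₀ = (List.replicate r v).flatten := ⟨_, w.rotate k₀, 1, rfl, by simp⟩
  classical
  obtain ⟨v, r, hv, hr⟩ := Nat.find_spec hex
  have hwne : w.rotate k₀ ≠ [] := by simpa [List.rotate_eq_nil_iff] using hw
  have hvne : v ≠ [] := by
    rintro rfl
    exact hwne (by rw [hr]; simp)
  obtain ⟨r, rfl⟩ : ∃ r', r = r' + 1 := by
    cases r with
    | zero => exact absurd (by rw [hr]; simp) hwne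
    | succ r => exact ⟨r, rfl⟩
  have hvpos := List.length_pos_of_ne_nil hvne
  have hlyn : IsLyndonWord v := by
    refine ⟨hvne, ?_, ?_⟩
    · rintro u s hs rfl
      refine Nat.find_min hex (m := u.length) ?_ ⟨u, (r + 1) * s, rfl, ?_⟩
      · rw [← hv]
        have hu : 0 < u.length := by
          rcases Nat.eq_zero_or_pos u.length with h | h
          · simp [List.length_eq_zero_iff.mp h] at hvne
          · exact h
        simp only [List.length_flatten, List.map_replicate, List.sum_replicate, smul_eq_mul]
        nlinarith
      · rw [hr, List.flatten_replicate_mul]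
    · intro k
      by_contra hlt
      rw [not_le] at hlt
      have h1 : (w.rotate k₀).rotate k < w.rotate k₀ := by
        rw [hr, List.rotate_flatten_replicate, List.flatten_replicate_succ,
          List.flatten_replicate_succ]
        exact List.append_lt_append_of_length_eq hlt (by simp) _ _
      rw [List.rotate_rotate] at h1
      exact absurd (hmin' _) (not_le.mpr h1)
  -- Rotating on by `|w| - k₀` completes a full turn; on a power of `v` only its residue modulo
  -- `|v|` matters.
  refine ⟨⟨⟨v, hlyn⟩, r, ⟨(w.length - k₀) % v.length, Nat.mod_lt _ hvpos⟩⟩, ?_⟩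
  simp only [lyndonRotation]
  rw [List.rotate_flatten_replicate, List.rotate_mod, ← List.rotate_flatten_replicate, ← hr,
    List.rotate_rotate, Nat.add_sub_cancel' hk₀.le, List.rotate_length]

end LyndonRotation

/-! ### Cyclic products, their invariance, and traces of matrix powers -/

section CyclicProd

variable {α : Type*}

/-- The product `a i₁ i₂ * a i₂ i₃ * ⋯ * a i_d j` along the word `i₁ i₂ ⋯ i_d` ending in `j`. -/
noncomputable def pathProd (a : α → α → ℍ[ℝ]) : List α → α → ℍ[ℝ]
  | [], _ => 1
  | i :: l, j => a i (l.headD j) * pathProd a l j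

variable (a : α → α → ℍ[ℝ])

theorem pathProd_append (l l' : List α) (j : α) :
    pathProd a (l ++ l') j = pathProd a l (l'.headD j) * pathProd a l' j := by
  induction l with
  | nil => simp [pathProd]
  | cons i l ih =>
    rw [List.cons_append, pathProd, pathProd, ih, mul_assoc]
    cases l <;> simp

theorem cyclicProd_cons (i : α) (l : List α) : cyclicProd a (i :: l) = pathProd a (i :: l) i := by
  have key : ∀ (l : List α) (i j : α),
      (List.zipWith a (i :: l) (l ++ [j])).prod = pathProd a (i :: l) j := by
    intro l
    induction l with
    | nil => intro i j; simp [pathProd]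
    | cons k l ih =>
      intro i j
      rw [List.cons_append, List.zipWith_cons_cons, List.prod_cons, ih]
      simp [pathProd]
  rw [← key, cyclicProd]
  simp

theorem pathProd_flatten_replicate (i : α) (l : List α) (r : ℕ) :
    pathProd a (List.replicate r (i :: l)).flatten i = cyclicProd a (i :: l) ^ r := by
  induction r with
  | zero => simp [pathProd]
  | succ r ih =>
    rw [List.flatten_replicate_succ, pathProd_append, ih, pow_succ', cyclicProd_cons]
    congr 2
    cases r <;> simp [List.replicate_succ]

theorem cyclicProd_flatten_replicate (l : List α) (r : ℕ) :
    cyclicProd a (List.replicate r l).flatten = cyclicProd a l ^ r := by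
  cases l with
  | nil => simp [cyclicProd]
  | cons i l =>
    rw [← pathProd_flatten_replicate]
    cases r with
    | zero => simp [cyclicProd, pathProd]
    | succ r => rw [List.flatten_replicate_succ, List.cons_append, cyclicProd_cons]

/-- Quaternions do not commute, but `Re (x * y) = Re (y * x)`. -/
theorem re_cyclicProd_rotate (l : List α) (k : ℕ) :
    (cyclicProd a (l.rotate k)).re = (cyclicProd a l).re := by
  have key : ∀ l : List α, (cyclicProd a (l.rotate 1)).re = (cyclicProd a l).re := by
    intro l
    rcases l with _ | ⟨i, _ | ⟨j, l⟩⟩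
    · simp
    · simp
    · rw [List.rotate_cons_succ, List.rotate_zero, List.cons_append, cyclicProd_cons,
        cyclicProd_cons, ← List.cons_append, pathProd_append, pathProd]
      have hcomm : ∀ x y : ℍ[ℝ], (x * y).re = (y * x).re := fun x y => by simp; ring
      rw [hcomm]
      simp [pathProd]
  induction k with
  | zero => simp
  | succ k ih => rw [← List.rotate_rotate, key, ih]

/-- A real `t` is central in the quaternions, so its powers can be collected on the right. -/
theorem cyclicProd_mul_pow (t : ℝ) (l : List α) :
    cyclicProd (fun i j => (t : ℍ[ℝ]) * a i j) l = cyclicProd a l * (t : ℍ[ℝ]) ^ l.length := by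
  have key : ∀ (l : List α) (j : α),
      pathProd (fun i j => (t : ℍ[ℝ]) * a i j) l j = pathProd a l j * (t : ℍ[ℝ]) ^ l.length := by
    intro l j
    induction l with
    | nil => simp [pathProd]
    | cons i l ih =>
      rw [pathProd, ih, pathProd, List.length_cons, pow_succ', Quaternion.coe_commutes, mul_assoc,
        mul_assoc, ← mul_assoc (t : ℍ[ℝ]), Quaternion.coe_commutes, mul_assoc]
  cases l with
  | nil => simp [cyclicProd]
  | cons i l => rw [cyclicProd_cons, cyclicProd_cons, key]

theorem norm_cyclicProd_le {c : ℝ} (hc : ∀ i j, ‖a i j‖ ≤ c) (l : List α) :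
    ‖cyclicProd a l‖ ≤ c ^ l.length := by
  have key : ∀ (l : List α) (j : α), ‖pathProd a l j‖ ≤ c ^ l.length := by
    intro l j
    induction l with
    | nil => simp [pathProd]
    | cons i l ih =>
      rw [pathProd, norm_mul, List.length_cons, pow_succ']
      have hc0 : 0 ≤ c := (norm_nonneg _).trans (hc i j)
      exact mul_le_mul (hc _ _) ih (norm_nonneg _) hc0
  cases l with
  | nil => simp [cyclicProd]
  | cons i l => rw [cyclicProd_cons]; exact key _ _

theorem sum_pathProd_ofFn [Fintype α] [DecidableEq α] (k : ℕ) (i j : α) :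
    ∑ w : Fin k → α, pathProd a (i :: List.ofFn w) j = (Matrix.of a ^ (k + 1)) i j := by
  induction k generalizing i with
  | zero => simp [pathProd]
  | succ k ih =>
    rw [← (Fin.consEquiv fun _ => α).sum_comp, Fintype.sum_prod_type, pow_succ', Matrix.mul_apply]
    refine Finset.sum_congr rfl fun x _ => ?_
    rw [← ih, Finset.mul_sum]
    refine Finset.sum_congr rfl fun w _ => ?_
    rw [pathProd]
    simp [Fin.consEquiv, List.ofFn_succ]

theorem sum_cyclicProd_ofFn [Fintype α] [DecidableEq α] (k : ℕ) :
    ∑ w : Fin (k + 1) → α, cyclicProd a (List.ofFn w) = ∑ i, (Matrix.of a ^ (k + 1)) i i := by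
  rw [← (Fin.consEquiv fun _ => α).sum_comp, Fintype.sum_prod_type]
  refine Finset.sum_congr rfl fun i _ => ?_
  rw [← sum_pathProd_ofFn]
  refine Finset.sum_congr rfl fun w _ => ?_
  rw [← cyclicProd_cons]
  simp [Fin.consEquiv, List.ofFn_succ]

end CyclicProd

/-! ### From the sum over words to the product over Lyndon words -/

section EulerProduct

theorem Quaternion.re_sum {κ : Type*} (u : Finset κ) (f : κ → ℍ[ℝ]) :
    (∑ i ∈ u, f i).re = ∑ i ∈ u, (f i).re :=
  map_sum (AddMonoidHom.mk' (fun q : ℍ[ℝ] => q.re) fun _ _ => rfl) f u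

variable {α : Type*} [Fintype α]

theorem hasSum_re_cyclicProd_div_length [DecidableEq α] {a : α → α → ℍ[ℝ]} {c : ℝ} (hc0 : 0 ≤ c)
    (hM : ∀ i j, ‖a i j‖ ≤ c) (hc : 2 * Fintype.card α * c < 1) {s : ℝ}
    (hs : HasSum (fun k : ℕ => (∑ i, 2 * ((Matrix.of a ^ k) i i).re) / (k : ℝ)) s) :
    HasSum (fun w : List α => 2 * (cyclicProd a w).re / (w.length : ℝ)) s := by
  rw [← List.equivSigmaTuple.symm.hasSum_iff]
  have hsummable : Summable ((fun w : List α => 2 * (cyclicProd a w).re / (w.length : ℝ)) ∘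
      List.equivSigmaTuple.symm) := by
    -- There are `card α ^ n` words of length `n`, so the majorant is geometric with ratio `card α *
    -- c < 1 / 2`.
    have hg : Summable fun p : Σ n, Fin n → α => 2 * c ^ p.1 := by
      rw [summable_sigma_of_nonneg fun _ => by positivity]
      refine ⟨fun _ => Summable.of_finite, ?_⟩
      have hgeo : Summable fun n : ℕ => 2 * (Fintype.card α * c) ^ n :=
        (summable_geometric_of_lt_one (by positivity) (by nlinarith)).mul_left 2
      refine hgeo.congr fun n => ?_
      simp [tsum_fintype, mul_pow]
      ring
    refine Summable.of_norm_bounded hg ?_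
    rintro ⟨n, w⟩
    have h1 : ‖cyclicProd a (List.ofFn w)‖ ≤ c ^ n := by
      simpa using norm_cyclicProd_le a hM (List.ofFn w)
    have h2 : |(cyclicProd a (List.ofFn w)).re| ≤ ‖cyclicProd a (List.ofFn w)‖ := by
      rw [← sq_le_sq₀ (abs_nonneg _) (norm_nonneg _), sq_abs, sq ‖_‖,
        ← Quaternion.normSq_eq_norm_mul_self, Quaternion.normSq_def']
      nlinarith [sq_nonneg (cyclicProd a (List.ofFn w)).imI,
        sq_nonneg (cyclicProd a (List.ofFn w)).imJ, sq_nonneg (cyclicProd a (List.ofFn w)).imK]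
    have h3 : ‖2 * (cyclicProd a (List.ofFn w)).re / ((List.ofFn w).length : ℝ)‖ ≤
        2 * |(cyclicProd a (List.ofFn w)).re| := by
      rw [norm_div, norm_mul, Real.norm_two, Real.norm_eq_abs, List.length_ofFn, Real.norm_natCast]
      rcases Nat.eq_zero_or_pos n with rfl | hn
      · simp
      · exact div_le_self (by positivity) (by exact_mod_cast hn)
    exact h3.trans (by linarith)
  have hsig := hsummable.hasSum.sigma fun n => hasSum_fintype _
  have hfib : ∀ n : ℕ, ∑ w : Fin n → α,
      ((fun w : List α => 2 * (cyclicProd a w).re / (w.length : ℝ)) ∘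
        List.equivSigmaTuple.symm) ⟨n, w⟩ =
      (∑ i, 2 * ((Matrix.of a ^ n) i i).re) / (n : ℝ) := by
    intro n
    cases n with
    | zero => simp [List.equivSigmaTuple]
    | succ n =>
      have h : ∑ w : Fin (n + 1) → α, (cyclicProd a (List.ofFn w)).re =
          ∑ i, ((Matrix.of a ^ (n + 1)) i i).re := by
        rw [← Quaternion.re_sum, ← Quaternion.re_sum, sum_cyclicProd_ofFn]
      rw [← Finset.mul_sum, ← h, Finset.mul_sum, Finset.sum_div]
      simp [List.equivSigmaTuple]
  simp only [hfib] at hsig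
  rw [← hsig.unique hs]
  exact hsummable.hasSum

theorem hasProd_norm_one_sub_cyclicProd [LinearOrder α] {a : α → α → ℍ[ℝ]} {c : ℝ}
    (hc0 : 0 ≤ c) (hM : ∀ i j, ‖a i j‖ ≤ c) (hc : 2 * Fintype.card α * c < 1) :
    studyDet (1 - Matrix.of a) ≠ 0 ∧
    (∀ l : {l : List α // IsLyndonWord l}, 1 - cyclicProd a l.1 ≠ 0) ∧
    HasProd (fun l : {l : List α // IsLyndonWord l} =>
      ((‖1 - cyclicProd a l.1‖ ^ (-2 : ℤ) : ℝ) : ℂ)) (studyDet (1 - Matrix.of a))⁻¹ := by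
  obtain ⟨h0, s, hs, he⟩ := exists_hasSum_studyDet (M := Matrix.of a) hM hc
  have hq : ∀ l : {l : List α // IsLyndonWord l}, 2 * ‖cyclicProd a l.1‖ < 1 := by
    rintro ⟨l, hl⟩
    -- The letters of a Lyndon word show that `α` is nonempty, which turns `hc` into `2 * c < 1`.
    have hcard : (1 : ℝ) ≤ Fintype.card α := by
      obtain ⟨i, -⟩ := List.exists_mem_of_ne_nil l hl.1
      exact_mod_cast Fintype.card_pos_iff.mpr ⟨i⟩
    have hc2 : 2 * c < 1 := by nlinarith
    have h1 : c ^ l.length ≤ c := pow_le_of_le_one hc0 (by linarith) hl.length_pos.ne'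
    have h2 := norm_cyclicProd_le a hM l
    linarith
  have hne : ∀ l : {l : List α // IsLyndonWord l}, 1 - cyclicProd a l.1 ≠ 0 := by
    intro l h
    have := hq l
    rw [← sub_eq_zero.mp h] at this
    norm_num at this
  refine ⟨h0, hne, ?_⟩
  have hwords := hasSum_re_cyclicProd_div_length hc0 hM hc hs
  have hsig : HasSum ((fun w : List α => 2 * (cyclicProd a w).re / (w.length : ℝ)) ∘
      lyndonRotation) s := by
    -- Only the empty word is missed, and its term is 0 because division by length 0 gives 0.
    refine (lyndonRotation_injective.hasSum_iff fun w hw => ?_).mpr hwords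
    have : w = [] := by
      by_contra hne
      exact hw (exists_lyndonRotation_eq hne)
    simp [this]
  have hlog : HasSum (fun l : {l : List α // IsLyndonWord l} =>
      Real.log (‖1 - cyclicProd a l.1‖ ^ (-2 : ℤ))) s := by
    refine hsig.sigma fun l => ?_
    have hfib := hsig.summable.sigma_factor l
    have hpos : (0 : ℝ) < l.1.length := by exact_mod_cast l.2.length_pos
    have hrow := hfib.hasSum.prod_fiberwise fun r => hasSum_fintype _
    have hval : HasSum (fun r : ℕ => 2 * (cyclicProd a l.1 ^ (r + 1)).re / ((r + 1 : ℕ) : ℝ))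
        (Real.log (‖1 - cyclicProd a l.1‖ ^ (-2 : ℤ))) := by
      have := (hasSum_nat_add_iff' 1).mpr (hasSum_log_norm_one_sub (hq l))
      simpa using this
    have hrow_eq : ∀ r : ℕ, ∑ j : Fin l.1.length,
        ((fun w : List α => 2 * (cyclicProd a w).re / (w.length : ℝ)) ∘ lyndonRotation)
          ⟨l, r, j⟩ = 2 * (cyclicProd a l.1 ^ (r + 1)).re / ((r + 1 : ℕ) : ℝ) := by
      intro r
      simp only [Function.comp_apply, lyndonRotation, re_cyclicProd_rotate, List.length_rotate,
        cyclicProd_flatten_replicate, Finset.sum_const, Finset.card_univ, Fintype.card_fin,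
        nsmul_eq_mul, List.length_flatten, List.map_replicate, List.sum_replicate, smul_eq_mul]
      push_cast
      -- The `|l|` equal terms cancel the `|l|` in the word length `(r + 1) * |l|`.
      field_simp
    simp only [hrow_eq] at hrow
    rw [← hrow.unique hval]
    exact hfib.hasSum
  have hprod : HasProd (fun l : {l : List α // IsLyndonWord l} =>
      ‖1 - cyclicProd a l.1‖ ^ (-2 : ℤ)) (Real.exp s) :=
    Real.hasProd_of_hasSum_log
      (fun l => zpow_pos (norm_pos_iff.mpr (hne l)) _) hlog
  rw [← he]
  exact hprod.map Complex.ofRealHom Complex.continuous_ofReal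

end EulerProduct

theorem corollary5p6 {V : Type*} [Fintype V] [DecidableEq V]
    (G : SimpleGraph V) [DecidableRel G.Adj] (hG : G.Connected)
    (W : Matrix V V ℍ[ℝ]) (hW : IsQuatWeightedMatrix G W)
    (m : ℕ) (hm : m = G.edgeFinset.card)
    (e : Fin (2 * m) ≃ G.Dart)
    (t : ℝ) (ht : ∀ f g : G.Dart, |t| * ‖wTilde G W f g‖ < 1 / (8 * (m : ℝ) ^ 2)) :
    zetaDet G W (t : ℍ[ℝ]) ≠ 0 ∧
    (∀ l : {l : List (Fin (2 * m)) // IsLyndonWord l},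
      1 - cyclicProd (fun i j => wTilde G W (e i) (e j)) l.1 * (t : ℍ[ℝ]) ^ l.1.length ≠ 0) ∧
    HasProd
      (fun l : {l : List (Fin (2 * m)) // IsLyndonWord l} =>
        ((‖1 - cyclicProd (fun i j => wTilde G W (e i) (e j)) l.1 *
            (t : ℍ[ℝ]) ^ l.1.length‖ ^ (-2 : ℤ) : ℝ) : ℂ))
      (quatZeta G W (t : ℍ[ℝ])) := by
  have ha : ∀ i j, ‖(t : ℍ[ℝ]) * wTilde G W (e i) (e j)‖ ≤ 1 / (8 * (m : ℝ) ^ 2) := fun i j => by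
    rw [norm_mul, Quaternion.norm_coe, Real.norm_eq_abs]
    exact (ht _ _).le
  have hc : 2 * (Fintype.card (Fin (2 * m)) : ℝ) * (1 / (8 * (m : ℝ) ^ 2)) < 1 := by
    rw [Fintype.card_fin]
    -- For positive `m` the left side is `4m / (8m²) = 1 / (2m)`; for `m = 0` it is 0.
    rcases Nat.eq_zero_or_pos m with rfl | hpos
    · simp
    · have h1 : (1 : ℝ) ≤ m := by exact_mod_cast hpos
      rw [mul_one_div, div_lt_one (by positivity)]
      push_cast
      nlinarith
  have hdet : zetaDet G W (t : ℍ[ℝ]) =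
      studyDet (1 - Matrix.of fun i j => (t : ℍ[ℝ]) * wTilde G W (e i) (e j)) := by
    rw [zetaDet, ← studyDet_submatrix_equiv e]
    congr 1
    ext1 i j
    simp [wTilde, Matrix.one_apply]
  rw [quatZeta, hdet]
  simp only [← cyclicProd_mul_pow]
  exact hasProd_norm_one_sub_cyclicProd (by positivity) ha hc
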